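/- Let $A,B$ be unital associative rings and let $M$ be a $B$-$A$ bimodule which is a generator in the category of left $B$-modules. For a $B$-bimodule $Y$, regard the group ${}_B\mathrm{Hom}(M,Y)$ of left $B$-linear maps as an $A$-$B$ bimodule via $(afb)(m)=f(ma)\,b$, and put ${}^*M={}_B\mathrm{Hom}(M,B)$. Let $\mathcal E_{M,B}$ be the class of all $B$-bimodule maps $f$ such that ${}_B\mathrm{Hom}(M,f)$ has a section that is a map of $A$-$B$ bimodules. A $B$-bimodule $P$ is called $\mathcal E_{M,B}$-projective if for every $f\colon Y\to Y'$ in $\mathcal E_{M,B}$ each bimodule map $P\to Y'$ factors through $f$. An exact sequence of $B$-bimodules is called $\mathcal E_{M,B}$-exact if each of its maps is the composite of an epimorphism lying in $\mathcal E_{M,B}$ and a monomorphism. For a $B$-bimodule $N$ let $\mathrm H_M^n(B,N)=\mathrm{Ext}^n_{\mathcal E_{M,B}}(B,N)$ be the $n$-th cohomology of the complex ${}_B\mathrm{Hom}_B(P_\bullet,N)$, where $\cdots\to P_1\to P_0\to B\to 0$ is an $\mathcal E_{M,B}$-exact sequence with all $P_i$ $\mathcal E_{M,B}$-projective (such a sequence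 exists, and the cohomology does not depend on its choice). Let $\mathrm{Hdim}_M(B)$ be the least integer $n\ge 0$ such that $\mathrm H_M^{n+1}(B,N)=0$ for every $B$-bimodule $N$, and $\infty$ if there is no such $n$. Then the following assertions are equivalent: (a) $M$ is formally smooth, i.e. the kernel of the evaluation map $\mathrm{ev}_M\colon M\otimes_A{}^*M\to B$, $m\otimes f\mapsto f(m)$, is an $\mathcal E_{M,B}$-projective $B$-bimodule; (b) $\mathrm H_M^n(B,N)=0$ for all $B$-bimodules $N$ and all $n\ge 2$; (c) $\mathrm H_M^2(B,N)=0$ for all $B$-bimodules $N$; (d) $\mathrm{Hdim}_M(B)\le 1$. -/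

import Mathlib

open CategoryTheory CategoryTheory.Limits
open scoped TensorProduct MulOpposite

universe u v w

/-! ## Relative projectivity and relative derived functors -/

namespace RelativeHomology

section Projective

variable {C : Type u} [Category.{v} C]

/-- `P` is `f`-projective: composing with `f` is surjective on morphisms out of `P`. -/
def IsProjectiveFor (P : C) {X Y : C} (f : X ⟶ Y) : Prop :=
  Function.Surjective (fun g : P ⟶ X => g ≫ f)

/-- `P` is `H`-projective: it is `f`-projective for every `f` in the class `H`. -/
def IsRelProjective (H : MorphismProperty C) (P : C) : Prop :=
  ∀ ⦃X Y : C⦄ (f : X ⟶ Y), H f → IsProjectiveFor P f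

/-- The class of morphisms `f` such that `R f` splits, i.e. has a section. -/
def relSplit {D : Type*} [Category* D] (R : C ⥤ D) : MorphismProperty C :=
  fun _ _ f => ∃ s, s ≫ R.map f = 𝟙 _

end Projective

section Cover

variable {C : Type u} [Category.{v} C] {H : MorphismProperty C}
  (hH : ∀ Y : C, ∃ (P : C) (f : P ⟶ Y), Epi f ∧ H f ∧ IsRelProjective H P)

/-- A chosen `H`-projective object mapping onto `Y` through `H`. -/
noncomputable def cover (Y : C) : C := (hH Y).choose

/-- A chosen epimorphism in `H` from an `H`-projective object onto `Y`. -/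
noncomputable def proj (Y : C) : cover hH Y ⟶ Y := (hH Y).choose_spec.choose

instance proj_epi (Y : C) : Epi (proj hH Y) := (hH Y).choose_spec.choose_spec.1

lemma proj_mem (Y : C) : H (proj hH Y) := (hH Y).choose_spec.choose_spec.2.1

lemma cover_projective (Y : C) : IsRelProjective H (cover hH Y) :=
  (hH Y).choose_spec.choose_spec.2.2

end Cover

section Resolution

variable {C : Type u} [Category.{v} C] [Abelian C]

/-- A morphism is `H`-admissible if in its canonical factorization as an epimorphism `ξ`
followed by a monomorphism `μ` (unique up to isomorphism), `ξ` belongs to `H`. -/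
def IsAdmissible (H : MorphismProperty C) {X Y : C} (f : X ⟶ Y) : Prop :=
  ∃ (I : C) (ξ : X ⟶ I) (μ : I ⟶ Y), Epi ξ ∧ Mono μ ∧ ξ ≫ μ = f ∧ H ξ

/-- An `H`-projective resolution `⋯ ⟶ P₁ ⟶ P₀ ⟶ X ⟶ 0` of the object `X`. -/
structure RelProjectiveResolution (H : MorphismProperty C) (X : C) where
  /-- the complex `⋯ ⟶ P₁ ⟶ P₀` -/
  complex : ChainComplex C ℕ
  /-- the augmentation `P₀ ⟶ X` -/
  aug : complex.X 0 ⟶ X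
  projective : ∀ n, IsRelProjective H (complex.X n)
  d_aug : complex.d 1 0 ≫ aug = 0
  exact_succ : ∀ n, complex.ExactAt (n + 1)
  exact_zero : (ShortComplex.mk (complex.d 1 0) aug d_aug).Exact
  epi_aug : Epi aug
  admissible : ∀ n, IsAdmissible H (complex.d (n + 1) n)
  admissible_aug : IsAdmissible H aug

/-- The `n`-th cohomology group of the cochain complex `Hom(P_•, Y)`. -/
noncomputable def RelProjectiveResolution.ext {H : MorphismProperty C} {X : C}
    (P : RelProjectiveResolution H X) (Y : C) (n : ℕ) : ModuleCat.{v} ℤ :=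
  (P.complex.linearYonedaObj ℤ Y).homology n

section Existence

variable {H : MorphismProperty C}
  (hH : ∀ Y : C, ∃ (P : C) (f : P ⟶ Y), Epi f ∧ H f ∧ IsRelProjective H P)

/-- The next differential of the resolution. -/
noncomputable def nextD {X Y : C} (f : X ⟶ Y) : cover hH (kernel f) ⟶ X :=
  proj hH (kernel f) ≫ kernel.ι f

lemma nextD_comp {X Y : C} (f : X ⟶ Y) : nextD hH f ≫ f = 0 := by simp [nextD]

lemma nextD_admissible {X Y : C} (f : X ⟶ Y) : IsAdmissible H (nextD hH f) :=
  ⟨_, proj hH _, kernel.ι f, inferInstance, inferInstance, rfl, proj_mem hH _⟩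

lemma nextD_exact {X Y : C} (f : X ⟶ Y) :
    (ShortComplex.mk (nextD hH f) f (nextD_comp hH f)).Exact := by
  let α : ShortComplex.mk (nextD hH f) f (nextD_comp hH f) ⟶
      ShortComplex.mk (kernel.ι f) f (by simp) :=
    { τ₁ := proj hH _
      τ₂ := 𝟙 _
      τ₃ := 𝟙 _
      comm₁₂ := by simp [nextD] }
  have : Epi α.τ₁ := inferInstanceAs (Epi (proj hH _))
  have : IsIso α.τ₂ := inferInstanceAs (IsIso (𝟙 _))
  have : Mono α.τ₃ := inferInstanceAs (Mono (𝟙 _))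
  rw [ShortComplex.exact_iff_of_epi_of_isIso_of_mono α]
  apply ShortComplex.exact_of_f_is_kernel
  apply kernelIsKernel

/-- The successive differentials of the resolution, starting with the augmentation. -/
noncomputable def stage (X : C) : ℕ → Arrow C
  | 0 => Arrow.mk (proj hH X)
  | n + 1 => Arrow.mk (nextD hH (stage X n).hom)

/-- The complex of the resolution. -/
noncomputable def resComplex (X : C) : ChainComplex C ℕ :=
  ChainComplex.of (fun n => (stage hH X n).left) (fun n => (stage hH X (n + 1)).hom)
    (fun n => nextD_comp hH (stage hH X (n + 1)).hom)

lemma resComplex_d (X : C) (n : ℕ) :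
    (resComplex hH X).d (n + 1) n = nextD hH (stage hH X n).hom :=
  ChainComplex.of_d (fun n => (stage hH X n).left) (fun n => (stage hH X (n + 1)).hom) n

lemma resComplex_projective (X : C) (n : ℕ) : IsRelProjective H ((resComplex hH X).X n) := by
  cases n <;> exact cover_projective hH _

lemma exact_congr {X Y Z : C} {f f' : X ⟶ Y} {g g' : Y ⟶ Z} (hf : f = f') (hg : g = g')
    (w : f ≫ g = 0) (w' : f' ≫ g' = 0) (h : (ShortComplex.mk f' g' w').Exact) :
    (ShortComplex.mk f g w).Exact := by
  subst hf hg; exact h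

lemma resComplex_exactAt (X : C) (n : ℕ) : (resComplex hH X).ExactAt (n + 1) := by
  rw [HomologicalComplex.exactAt_iff' _ (n + 1 + 1) (n + 1) n (by simp) (by simp)]
  exact exact_congr (resComplex_d hH X (n + 1)) (resComplex_d hH X n) _ _
    (nextD_exact hH (nextD hH (stage hH X n).hom))

lemma resComplex_admissible (X : C) (n : ℕ) :
    IsAdmissible H ((resComplex hH X).d (n + 1) n) := by
  rw [resComplex_d]; exact nextD_admissible hH _

end Existence

/-- Relative projective resolutions exist as soon as every object is the target of an epimorphism
in `H` with `H`-projective source. -/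
lemma exists_resolution {H : MorphismProperty C}
    (hH : ∀ Y : C, ∃ (P : C) (f : P ⟶ Y), Epi f ∧ H f ∧ IsRelProjective H P) (X : C) :
    Nonempty (RelProjectiveResolution H X) :=
  ⟨{complex := resComplex hH X
    aug := proj hH X
    projective := resComplex_projective hH X
    d_aug := (congrArg (fun t => t ≫ proj hH X) (resComplex_d hH X 0)).trans (nextD_comp hH _)
    exact_succ := resComplex_exactAt hH X
    exact_zero := exact_congr (resComplex_d hH X 0) rfl _ _ (nextD_exact hH (proj hH X))
    epi_aug := proj_epi hH X
    admissible := resComplex_admissible hH X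
    admissible_aug := ⟨X, proj hH X, 𝟙 X, proj_epi hH X, inferInstance, Category.comp_id _,
      proj_mem hH X⟩}⟩

end Resolution

end RelativeHomology

/-! ## The category of bimodules -/

/-- A (unital) `B`-`C` bimodule: an abelian group with commuting left `B`-action and right
`C`-action, the latter being written as a left action of `Cᵐᵒᵖ`. -/
structure BimoduleCat (B : Type u) (C : Type v) [Ring B] [Ring C] where
  /-- the underlying type -/
  carrier : Type w
  [addCommGroup : AddCommGroup carrier]
  [leftModule : Module B carrier]
  [rightModule : Module Cᵐᵒᵖ carrier]
  [smulComm : SMulCommClass B Cᵐᵒᵖ carrier]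

namespace BimoduleCat

attribute [instance] addCommGroup leftModule rightModule smulComm

section Category

variable {B : Type u} {C : Type v} [Ring B] [Ring C]

instance : CoeSort (BimoduleCat.{u, v, w} B C) (Type w) := ⟨carrier⟩

/-- Bimodule maps: left `B`-linear maps that are also right `C`-linear. -/
@[ext]
structure Hom (X Y : BimoduleCat.{u, v, w} B C) where
  /-- the underlying left linear map -/
  lin : X →ₗ[B] Y
  map_op_smul : ∀ (c : Cᵐᵒᵖ) (x : X), lin (c • x) = c • lin x

instance : Category.{w} (BimoduleCat.{u, v, w} B C) where
  Hom := Hom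
  id X := ⟨LinearMap.id, fun _ _ => rfl⟩
  comp f g := ⟨g.lin ∘ₗ f.lin, fun c x => by simp [f.map_op_smul, g.map_op_smul]⟩

@[ext]
lemma hom_ext {X Y : BimoduleCat.{u, v, w} B C} {f g : X ⟶ Y} (h : ∀ x, f.lin x = g.lin x) :
    f = g :=
  Hom.ext (LinearMap.ext h)

@[simp]
lemma id_lin (X : BimoduleCat.{u, v, w} B C) : Hom.lin (𝟙 X) = LinearMap.id := rfl

@[simp]
lemma comp_lin {X Y Z : BimoduleCat.{u, v, w} B C} (f : X ⟶ Y) (g : Y ⟶ Z) :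
    (f ≫ g).lin = g.lin ∘ₗ f.lin := rfl

lemma lin_injective (X Y : BimoduleCat.{u, v, w} B C) :
    Function.Injective (fun f : X ⟶ Y => f.lin) := fun _ _ h => Hom.ext h

section Additive

variable (X Y : BimoduleCat.{u, v, w} B C)

instance : Zero (X ⟶ Y) := ⟨⟨0, fun _ _ => by simp⟩⟩

instance : Add (X ⟶ Y) :=
  ⟨fun f g => ⟨f.lin + g.lin, fun c x => by simp [f.map_op_smul, g.map_op_smul]⟩⟩

instance : Neg (X ⟶ Y) := ⟨fun f => ⟨-f.lin, fun c x => by simp [f.map_op_smul]⟩⟩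

instance : Sub (X ⟶ Y) :=
  ⟨fun f g => ⟨f.lin - g.lin, fun c x => by simp [f.map_op_smul, g.map_op_smul, smul_sub]⟩⟩

instance : SMul ℕ (X ⟶ Y) :=
  ⟨fun n f => ⟨n • f.lin, fun c x => by simp [f.map_op_smul, smul_comm n c]⟩⟩

instance : SMul ℤ (X ⟶ Y) :=
  ⟨fun n f => ⟨n • f.lin, fun c x => by simp [f.map_op_smul, smul_comm n c]⟩⟩

instance : AddCommGroup (X ⟶ Y) :=
  (lin_injective X Y).addCommGroup _ rfl (fun _ _ => rfl) (fun _ => rfl) (fun _ _ => rfl)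
    (fun _ _ => rfl) (fun _ _ => rfl)

end Additive

@[simp]
lemma add_lin {X Y : BimoduleCat.{u, v, w} B C} (f g : X ⟶ Y) :
    (f + g).lin = f.lin + g.lin := rfl

@[simp]
lemma zero_lin (X Y : BimoduleCat.{u, v, w} B C) : Hom.lin (0 : X ⟶ Y) = 0 := rfl

instance : Preadditive (BimoduleCat.{u, v, w} B C) where
  add_comp := by intros; ext; simp
  comp_add := by intros; ext; simp

lemma epi_of_surjective {X Y : BimoduleCat.{u, v, w} B C} (f : X ⟶ Y)
    (hf : Function.Surjective f.lin) : Epi f where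
  left_cancellation g h e := by
    ext y
    obtain ⟨x, rfl⟩ := hf y
    exact congrArg (fun k => k.lin x) e

/-! Bimodules are the modules over `B ⊗ Cᵐᵒᵖ`, hence form an abelian category. -/

attribute [local instance] TensorProduct.Algebra.module

lemma hom_tensor_smul {X Y : BimoduleCat.{u, v, w} B C} (f : X ⟶ Y) (r : B ⊗[ℤ] Cᵐᵒᵖ) (x : X) :
    f.lin (r • x) = r • f.lin x := by
  induction r using TensorProduct.induction_on with
  | zero => rw [zero_smul (B ⊗[ℤ] Cᵐᵒᵖ) x, zero_smul (B ⊗[ℤ] Cᵐᵒᵖ) (f.lin x), map_zero]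
  | tmul b c => simp [TensorProduct.Algebra.smul_def, f.map_op_smul]
  | add r s hr hs => simp_all [add_smul]

/-- A bimodule as a module over `B ⊗ Cᵐᵒᵖ`. -/
noncomputable def toModuleCat :
    BimoduleCat.{u, v, w} B C ⥤ ModuleCat.{w} (B ⊗[ℤ] Cᵐᵒᵖ) where
  obj X := ModuleCat.of (B ⊗[ℤ] Cᵐᵒᵖ) X
  map {X Y} f := ModuleCat.ofHom
    { toFun := f.lin
      map_add' := map_add f.lin
      map_smul' := hom_tensor_smul f }

instance : (toModuleCat (B := B) (C := C)).Faithful where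
  map_injective {X Y f g} h := by
    ext x
    exact congrArg (fun k => k.hom x) h

lemma tmul_one_smul (X : BimoduleCat.{u, v, w} B C) (b : B) (x : X) :
    (b ⊗ₜ[ℤ] (1 : Cᵐᵒᵖ)) • x = b • x := by
  rw [TensorProduct.Algebra.smul_def, one_smul]

lemma one_tmul_smul (X : BimoduleCat.{u, v, w} B C) (c : Cᵐᵒᵖ) (x : X) :
    ((1 : B) ⊗ₜ[ℤ] c) • x = c • x := by
  rw [TensorProduct.Algebra.smul_def, one_smul]

instance : (toModuleCat (B := B) (C := C)).Full where
  map_surjective {X Y} g :=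
    ⟨⟨{ toFun := g.hom
        map_add' := map_add g.hom
        map_smul' := fun b x => (congrArg g.hom (tmul_one_smul X b x)).symm.trans
          ((g.hom.map_smul (b ⊗ₜ[ℤ] (1 : Cᵐᵒᵖ)) x).trans (tmul_one_smul Y b (g.hom x))) },
      fun c x => (congrArg g.hom (one_tmul_smul X c x)).symm.trans
        ((g.hom.map_smul ((1 : B) ⊗ₜ[ℤ] c) x).trans (one_tmul_smul Y c (g.hom x)))⟩, rfl⟩

/-- A module over `B ⊗ Cᵐᵒᵖ` as a bimodule. -/
noncomputable def ofModule (Z : Type w) [AddCommGroup Z] [Module (B ⊗[ℤ] Cᵐᵒᵖ) Z] :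
    BimoduleCat.{u, v, w} B C :=
  { carrier := Z
    leftModule := Module.compHom Z
      (Algebra.TensorProduct.includeLeft : B →ₐ[ℤ] B ⊗[ℤ] Cᵐᵒᵖ).toRingHom
    rightModule := Module.compHom Z
      (Algebra.TensorProduct.includeRight : Cᵐᵒᵖ →ₐ[ℤ] B ⊗[ℤ] Cᵐᵒᵖ).toRingHom
    smulComm := by
      let _ := Module.compHom Z
        (Algebra.TensorProduct.includeLeft : B →ₐ[ℤ] B ⊗[ℤ] Cᵐᵒᵖ).toRingHom
      let _ := Module.compHom Z
        (Algebra.TensorProduct.includeRight : Cᵐᵒᵖ →ₐ[ℤ] B ⊗[ℤ] Cᵐᵒᵖ).toRingHom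
      refine ⟨fun b c z => ?_⟩
      change (b ⊗ₜ[ℤ] (1 : Cᵐᵒᵖ)) • ((1 : B) ⊗ₜ[ℤ] c) • z =
        ((1 : B) ⊗ₜ[ℤ] c) • (b ⊗ₜ[ℤ] (1 : Cᵐᵒᵖ)) • z
      simp [smul_smul] }

/-- The identity of the underlying group of a module over `B ⊗ Cᵐᵒᵖ`. -/
def fromOf (Z : Type w) [AddCommGroup Z] [Module (B ⊗[ℤ] Cᵐᵒᵖ) Z] :
    (ofModule Z : BimoduleCat.{u, v, w} B C) →+ Z :=
  AddMonoidHom.id Z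

lemma fromOf_smul (Z : Type w) [AddCommGroup Z] [Module (B ⊗[ℤ] Cᵐᵒᵖ) Z] (r : B ⊗[ℤ] Cᵐᵒᵖ)
    (z : (ofModule Z : BimoduleCat.{u, v, w} B C)) : fromOf Z (r • z) = r • fromOf Z z := by
  induction r using TensorProduct.induction_on with
  | zero => rw [zero_smul (B ⊗[ℤ] Cᵐᵒᵖ) z, zero_smul (B ⊗[ℤ] Cᵐᵒᵖ) (fromOf Z z), map_zero]
  | tmul b c =>
    rw [TensorProduct.Algebra.smul_def]
    change (b ⊗ₜ[ℤ] (1 : Cᵐᵒᵖ)) • ((1 : B) ⊗ₜ[ℤ] c) • fromOf Z z = (b ⊗ₜ[ℤ] c) • fromOf Z z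
    simp [smul_smul]
  | add r s hr hs =>
    rw [add_smul (R := B ⊗[ℤ] Cᵐᵒᵖ) r s z, map_add, hr, hs, add_smul]

instance : (toModuleCat (B := B) (C := C)).EssSurj where
  mem_essImage Z := by
    let e : (toModuleCat.obj (ofModule (Z : Type _) : BimoduleCat B C)) ≃ₗ[B ⊗[ℤ] Cᵐᵒᵖ] Z :=
      { toFun := fromOf (B := B) (C := C) Z
        map_add' := map_add (fromOf (B := B) (C := C) Z)
        map_smul' := fromOf_smul (B := B) (C := C) Z
        invFun := fun z => z
        left_inv := fun _ => rfl
        right_inv := fun _ => rfl }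
    exact ⟨ofModule Z, ⟨e.toModuleIso⟩⟩

instance : (toModuleCat (B := B) (C := C)).IsEquivalence where

instance : HasFiniteProducts (BimoduleCat.{u, v, w} B C) :=
  ⟨fun _ => Adjunction.hasLimitsOfShape_of_equivalence toModuleCat⟩

noncomputable instance : Abelian (BimoduleCat.{u, v, w} B C) :=
  abelianOfEquivalence toModuleCat

end Category

end BimoduleCat

/-! ## Hom, tensor product and evaluation -/

namespace BimoduleCat

variable {A : Type v} {B : Type u} {T : Type u} [Ring A] [Ring B] [Ring T]

/-- Right multiplication by (the element underlying) `a : Aᵐᵒᵖ`, as a left `B`-linear map. -/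
def rightMul (M : BimoduleCat.{u, v, u} B A) (a : Aᵐᵒᵖ) : M →ₗ[B] M where
  toFun m := a • m
  map_add' := smul_add a
  map_smul' b m := (smul_comm b a m).symm

/-- The left `A`-action `(a f)(m) = f(m a)` on left `B`-linear maps `M → Y`. -/
@[reducible]
def homLeftModule (M : BimoduleCat.{u, v, u} B A) (Y : BimoduleCat.{u, u, u} B T) :
    Module A (M →ₗ[B] Y) where
  smul a f := f ∘ₗ rightMul M (MulOpposite.op a)
  one_smul f := LinearMap.ext fun m => congrArg f (one_smul Aᵐᵒᵖ m)
  mul_smul a a' f := LinearMap.ext fun m =>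
    congrArg f (mul_smul (MulOpposite.op a') (MulOpposite.op a) m)
  smul_zero _ := rfl
  smul_add _ _ _ := rfl
  add_smul a a' f := LinearMap.ext fun m =>
    (congrArg f (add_smul (MulOpposite.op a) (MulOpposite.op a') m)).trans (map_add f _ _)
  zero_smul f := LinearMap.ext fun m => (congrArg f (zero_smul Aᵐᵒᵖ m)).trans (map_zero f)

/-- For bimodules `M` (over `B`, `A`) and `Y` (over `B`, `T`), the `A`-`T` bimodule of left
`B`-linear maps `M → Y`, where `(a f t)(m) = f(m a) t`. -/
def homObj (M : BimoduleCat.{u, v, u} B A) (Y : BimoduleCat.{u, u, u} B T) :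
    BimoduleCat.{v, u, u} A T :=
  { carrier := M →ₗ[B] Y
    leftModule := homLeftModule M Y
    smulComm :=
      let _ := homLeftModule M Y
      ⟨fun _ _ _ => rfl⟩ }

/-- An element of `homObj M Y` as a linear map. -/
def asLin {M : BimoduleCat.{u, v, u} B A} {Y : BimoduleCat.{u, u, u} B T} (f : homObj M Y) :
    M →ₗ[B] Y := f

@[simp]
lemma asLin_smul {M : BimoduleCat.{u, v, u} B A} {Y : BimoduleCat.{u, u, u} B T}
    (a : A) (f : homObj M Y) (m : M) : asLin (a • f) m = asLin f (MulOpposite.op a • m) := rfl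

@[simp]
lemma asLin_op_smul {M : BimoduleCat.{u, v, u} B A} {Y : BimoduleCat.{u, u, u} B T}
    (t : Tᵐᵒᵖ) (f : homObj M Y) (m : M) : asLin (t • f) m = t • asLin f m := rfl

/-- The functor `Hom_B(M, -)` from `B`-`T` bimodules to `A`-`T` bimodules. -/
def homFunctor (T : Type u) [Ring T] (M : BimoduleCat.{u, v, u} B A) :
    BimoduleCat.{u, u, u} B T ⥤ BimoduleCat.{v, u, u} A T where
  obj Y := homObj M Y
  map {Y Z} g :=
    { lin :=
        { toFun := fun f => g.lin ∘ₗ asLin f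
          map_add' := fun f f' => LinearMap.comp_add (asLin f) (asLin f') g.lin
          map_smul' := fun _ _ => rfl }
      map_op_smul := fun t f => LinearMap.ext fun m => g.map_op_smul t (asLin f m) }

/-- The class `𝓔_{M,T}` of maps `f` of `B`-`T` bimodules such that `Hom_B(M, f)` splits as a map
of `A`-`T` bimodules. -/
def splitClass (T : Type u) [Ring T] (M : BimoduleCat.{u, v, u} B A) :
    MorphismProperty (BimoduleCat.{u, u, u} B T) :=
  RelativeHomology.relSplit (homFunctor T M)

/-- The relations `m a ⊗ x = m ⊗ a x`. The set of relators is stable under left multiplication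
by `B`, so that its `B`-span is also the subgroup it generates. -/
def tensorRel (M : BimoduleCat.{u, v, u} B A) (X : BimoduleCat.{v, u, u} A T) :
    Submodule B (M ⊗[ℤ] X) :=
  Submodule.span B {z | ∃ (m : M) (a : A) (x : X), z = (MulOpposite.op a • m) ⊗ₜ[ℤ] x - m ⊗ₜ[ℤ] (a • x)}

/-- Right multiplication by `t` on `M ⊗[ℤ] X`. -/
noncomputable def tensorRight (M : BimoduleCat.{u, v, u} B A) (X : BimoduleCat.{v, u, u} A T)
    (t : Tᵐᵒᵖ) : M ⊗[ℤ] X →ₗ[B] M ⊗[ℤ] X :=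
  TensorProduct.AlgebraTensorModule.map LinearMap.id
    (DistribSMul.toAddMonoidHom X t : X →+ X).toIntLinearMap

lemma tensorRight_tmul (M : BimoduleCat.{u, v, u} B A) (X : BimoduleCat.{v, u, u} A T)
    (t : Tᵐᵒᵖ) (m : M) (x : X) : tensorRight M X t (m ⊗ₜ x) = m ⊗ₜ (t • x) := rfl

lemma tensorRel_le (M : BimoduleCat.{u, v, u} B A) (X : BimoduleCat.{v, u, u} A T) (t : Tᵐᵒᵖ) :
    tensorRel M X ≤ (tensorRel M X).comap (tensorRight M X t) := by
  refine Submodule.span_le.2 ?_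
  rintro _ ⟨m, a, x, rfl⟩
  refine Submodule.subset_span ⟨m, a, t • x, ?_⟩
  rw [map_sub, tensorRight_tmul, tensorRight_tmul, smul_comm a t x]

/-- The right action of `T` on `M ⊗_A X`. -/
noncomputable def tensorEnd (M : BimoduleCat.{u, v, u} B A) (X : BimoduleCat.{v, u, u} A T) :
    Tᵐᵒᵖ →+* Module.End B ((M ⊗[ℤ] X) ⧸ tensorRel M X) where
  toFun t := (tensorRel M X).mapQ (tensorRel M X) (tensorRight M X t) (tensorRel_le M X t)
  map_one' := by
    refine LinearMap.ext fun z => ?_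
    obtain ⟨z, rfl⟩ := Submodule.mkQ_surjective _ z
    induction z using TensorProduct.induction_on with
    | zero => simp
    | tmul m x => simp [tensorRight_tmul]
    | add z w hz hw => rw [map_add, map_add, hz, hw, map_add]
  map_mul' s t := by
    refine LinearMap.ext fun z => ?_
    obtain ⟨z, rfl⟩ := Submodule.mkQ_surjective _ z
    induction z using TensorProduct.induction_on with
    | zero => simp
    | tmul m x => simp [tensorRight_tmul, mul_smul]
    | add z w hz hw => rw [map_add, map_add, hz, hw, map_add]
  map_zero' := by
    refine LinearMap.ext fun z => ?_
    obtain ⟨z, rfl⟩ := Submodule.mkQ_surjective _ z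
    induction z using TensorProduct.induction_on with
    | zero => simp
    | tmul m x => simp [tensorRight_tmul]
    | add z w hz hw => rw [map_add, map_add, hz, hw, map_add]
  map_add' s t := by
    refine LinearMap.ext fun z => ?_
    obtain ⟨z, rfl⟩ := Submodule.mkQ_surjective _ z
    induction z using TensorProduct.induction_on with
    | zero => simp
    | tmul m x => simp [tensorRight_tmul, add_smul, TensorProduct.tmul_add]
    | add z w hz hw => rw [map_add, map_add, hz, hw, map_add]

/-- The tensor product `M ⊗_A X` of a `B`-`A` bimodule and an `A`-`T` bimodule, a `B`-`T`
bimodule. -/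
noncomputable def tensorObj (M : BimoduleCat.{u, v, u} B A) (X : BimoduleCat.{v, u, u} A T) :
    BimoduleCat.{u, u, u} B T :=
  { carrier := (M ⊗[ℤ] X) ⧸ tensorRel M X
    rightModule := Module.compHom _ (tensorEnd M X)
    smulComm :=
      let _ : Module Tᵐᵒᵖ ((M ⊗[ℤ] X) ⧸ tensorRel M X) := Module.compHom _ (tensorEnd M X)
      ⟨fun b t z => ((tensorEnd M X t).map_smul b z).symm⟩ }

/-- The pure tensor `m ⊗_A x`. -/
noncomputable def tmul {M : BimoduleCat.{u, v, u} B A} {X : BimoduleCat.{v, u, u} A T}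
    (m : M) (x : X) : tensorObj M X :=
  (tensorRel M X).mkQ (m ⊗ₜ[ℤ] x)

lemma op_smul_tmul {M : BimoduleCat.{u, v, u} B A} {X : BimoduleCat.{v, u, u} A T}
    (t : Tᵐᵒᵖ) (m : M) (x : X) : t • tmul m x = tmul m (t • x) := rfl

lemma smul_tmul {M : BimoduleCat.{u, v, u} B A} {X : BimoduleCat.{v, u, u} A T}
    (b : B) (m : M) (x : X) : b • tmul m x = tmul (b • m) x := rfl

lemma tmul_smul {M : BimoduleCat.{u, v, u} B A} {X : BimoduleCat.{v, u, u} A T}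
    (m : M) (a : A) (x : X) : tmul m (a • x) = tmul (MulOpposite.op a • m) x :=
  ((Submodule.Quotient.eq (tensorRel M X)).2 (Submodule.subset_span ⟨m, a, x, rfl⟩)).symm

lemma tensor_induction {M : BimoduleCat.{u, v, u} B A} {X : BimoduleCat.{v, u, u} A T}
    {p : tensorObj M X → Prop} (z : tensorObj M X) (zero : p 0) (pure : ∀ m x, p (tmul m x))
    (add : ∀ z w, p z → p w → p (z + w)) : p z := by
  obtain ⟨z, rfl⟩ := Submodule.mkQ_surjective (tensorRel M X) z
  induction z using TensorProduct.induction_on with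
  | zero => exact zero
  | tmul m x => exact pure m x
  | add z w hz hw => exact add _ _ hz hw

lemma tensor_hom_ext {M : BimoduleCat.{u, v, u} B A} {X : BimoduleCat.{v, u, u} A T}
    {Z : BimoduleCat.{u, u, u} B T} {f g : tensorObj M X ⟶ Z}
    (h : ∀ m x, f.lin (tmul m x) = g.lin (tmul m x)) : f = g :=
  hom_ext fun z => tensor_induction (p := fun z => f.lin z = g.lin z) z (by rw [map_zero, map_zero]) h
    fun z w hz hw => by rw [map_add, map_add, hz, hw]

/-- The `B`-linear map `M ⊗[ℤ] X → Z`, `m ⊗ x ↦ (g x) m`. -/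
noncomputable def liftAux {M : BimoduleCat.{u, v, u} B A} {X : BimoduleCat.{v, u, u} A T}
    {Z : BimoduleCat.{u, u, u} B T} (g : X ⟶ homObj M Z) : M ⊗[ℤ] X →ₗ[B] Z :=
  TensorProduct.AlgebraTensorModule.lift
    { toFun := fun m => AddMonoidHom.toIntLinearMap
        { toFun := fun x => asLin (g.lin x) m
          map_zero' := by rw [map_zero]; rfl
          map_add' := fun x y => by rw [map_add]; rfl }
      map_add' := fun m m' => LinearMap.ext fun x => map_add (asLin (g.lin x)) m m'
      map_smul' := fun b m => LinearMap.ext fun x => map_smul (asLin (g.lin x)) b m }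

lemma liftAux_tmul {M : BimoduleCat.{u, v, u} B A} {X : BimoduleCat.{v, u, u} A T}
    {Z : BimoduleCat.{u, u, u} B T} (g : X ⟶ homObj M Z) (m : M) (x : X) :
    liftAux g (m ⊗ₜ x) = asLin (g.lin x) m := rfl

lemma tensorRel_le_ker {M : BimoduleCat.{u, v, u} B A} {X : BimoduleCat.{v, u, u} A T}
    {Z : BimoduleCat.{u, u, u} B T} (g : X ⟶ homObj M Z) :
    tensorRel M X ≤ LinearMap.ker (liftAux g) := by
  refine Submodule.span_le.2 ?_
  rintro _ ⟨m, a, x, rfl⟩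
  rw [SetLike.mem_coe, LinearMap.mem_ker, map_sub, liftAux_tmul, liftAux_tmul, g.lin.map_smul,
    asLin_smul, sub_self]

/-- The map `M ⊗_A X → Z`, `m ⊗ x ↦ (g x) m` that corresponds to `g : X → Hom_B(M, Z)`. -/
noncomputable def lift {M : BimoduleCat.{u, v, u} B A} {X : BimoduleCat.{v, u, u} A T}
    {Z : BimoduleCat.{u, u, u} B T} (g : X ⟶ homObj M Z) : tensorObj M X ⟶ Z where
  lin := (tensorRel M X).liftQ (liftAux g) (tensorRel_le_ker g)
  map_op_smul t z := by
    let L : tensorObj M X →ₗ[B] Z := (tensorRel M X).liftQ (liftAux g) (tensorRel_le_ker g)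
    change L (t • z) = t • L z
    refine tensor_induction (p := fun z => L (t • z) = t • L z) z
      (by rw [smul_zero, map_zero, smul_zero]) (fun m x => ?_) (fun z w hz hw => ?_)
    · change asLin (g.lin (t • x)) m = t • asLin (g.lin x) m
      rw [g.map_op_smul, asLin_op_smul]
    · rw [smul_add, map_add, map_add, smul_add, hz, hw]

@[simp]
lemma lift_tmul {M : BimoduleCat.{u, v, u} B A} {X : BimoduleCat.{v, u, u} A T}
    {Z : BimoduleCat.{u, u, u} B T} (g : X ⟶ homObj M Z) (m : M) (x : X) :
    (lift g).lin (tmul m x) = asLin (g.lin x) m := rfl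

/-- The map `X → Hom_B(M, Z)`, `x ↦ (m ↦ g (m ⊗ x))` that corresponds to `g : M ⊗_A X → Z`. -/
noncomputable def unlift {M : BimoduleCat.{u, v, u} B A} {X : BimoduleCat.{v, u, u} A T}
    {Z : BimoduleCat.{u, u, u} B T} (g : tensorObj M X ⟶ Z) : X ⟶ homObj M Z where
  lin :=
    { toFun := fun x =>
        { toFun := fun m => g.lin (tmul m x)
          map_add' := fun m m' => by
            rw [← map_add]
            exact congrArg (fun z => g.lin ((tensorRel M X).mkQ z)) (TensorProduct.add_tmul m m' x)
          map_smul' := fun b m => by rw [← smul_tmul, map_smul]; rfl }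
      map_add' := fun x y => LinearMap.ext fun m => by
        refine Eq.trans ?_ (map_add g.lin (tmul m x) (tmul m y))
        exact congrArg (fun z => g.lin ((tensorRel M X).mkQ z)) (TensorProduct.tmul_add m x y)
      map_smul' := fun a x => LinearMap.ext fun m => congrArg g.lin (tmul_smul m a x) }
  map_op_smul t x := LinearMap.ext fun m =>
    (congrArg g.lin (op_smul_tmul t m x).symm).trans (g.map_op_smul t (tmul m x))

@[simp]
lemma unlift_apply {M : BimoduleCat.{u, v, u} B A} {X : BimoduleCat.{v, u, u} A T}
    {Z : BimoduleCat.{u, u, u} B T} (g : tensorObj M X ⟶ Z) (m : M) (x : X) :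
    asLin ((unlift g).lin x) m = g.lin (tmul m x) := rfl

/-- The counit `M ⊗_A Hom_B(M, Y) → Y`, `m ⊗ f ↦ f m`. -/
noncomputable def counit (M : BimoduleCat.{u, v, u} B A) (Y : BimoduleCat.{u, u, u} B T) :
    tensorObj M (homObj M Y) ⟶ Y :=
  lift (𝟙 (homObj M Y))

@[simp]
lemma counit_tmul (M : BimoduleCat.{u, v, u} B A) (Y : BimoduleCat.{u, u, u} B T) (m : M)
    (f : homObj M Y) : (counit M Y).lin (tmul m f) = asLin f m := rfl

/-- The ring `B` as a bimodule over itself. -/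
def regular (B : Type u) [Ring B] : BimoduleCat.{u, u, u} B B := { carrier := B }

/-- The dual `A`-`B` bimodule `Hom_B(M, B)`. -/
def dual (M : BimoduleCat.{u, v, u} B A) : BimoduleCat.{v, u, u} A B := homObj M (regular B)

/-- The evaluation map `M ⊗_A Hom_B(M, B) → B`, `m ⊗ f ↦ f m`. -/
noncomputable def ev (M : BimoduleCat.{u, v, u} B A) : tensorObj M (dual M) ⟶ regular B :=
  counit M (regular B)

/-- The bimodule `M` is formally smooth: the kernel of the evaluation map is a relatively
projective `B`-bimodule. -/
def IsFormallySmooth (M : BimoduleCat.{u, v, u} B A) : Prop :=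
  RelativeHomology.IsRelProjective (splitClass B M) (kernel (ev M))

/-! ## Hochschild cohomology relative to a bimodule -/

lemma tensorObj_projective (M : BimoduleCat.{u, v, u} B A) (X : BimoduleCat.{v, u, u} A T) :
    RelativeHomology.IsRelProjective (splitClass T M) (tensorObj M X) := by
  rintro Y Z f ⟨s, hs⟩ g
  refine ⟨lift (unlift g ≫ s), tensor_hom_ext fun m x => ?_⟩
  have h := congrArg (fun k => asLin (Hom.lin k ((unlift g).lin x)) m) hs
  exact h

lemma counit_mem (M : BimoduleCat.{u, v, u} B A) (Y : BimoduleCat.{u, u, u} B T) :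
    splitClass T M (counit M Y) :=
  ⟨unlift (𝟙 _), rfl⟩

lemma counit_epi (M : BimoduleCat.{u, v, u} B A) (hM : IsSeparator (ModuleCat.of B M))
    (Y : BimoduleCat.{u, u, u} B T) : Epi (counit M Y) := by
  refine epi_of_surjective _ (LinearMap.range_eq_top.1 ?_)
  set R : Submodule B Y := LinearMap.range (counit M Y).lin with hR
  have key : ModuleCat.ofHom R.mkQ = ModuleCat.ofHom 0 := by
    refine (isSeparator_def _).1 hM _ _ fun h => ?_
    ext m
    exact (Submodule.Quotient.mk_eq_zero R).2 ⟨tmul m (h.hom : homObj M Y), rfl⟩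
  rw [← Submodule.ker_mkQ R, LinearMap.ker_eq_top]
  exact congrArg ModuleCat.Hom.hom key

/-- If `M` is a generator as a left `B`-module, then every `B`-`T` bimodule has a relative
projective resolution. -/
lemma exists_resolution (M : BimoduleCat.{u, v, u} B A) (hM : IsSeparator (ModuleCat.of B M))
    (Y : BimoduleCat.{u, u, u} B T) :
    Nonempty (RelativeHomology.RelProjectiveResolution (splitClass T M) Y) :=
  RelativeHomology.exists_resolution
    (fun Z => ⟨_, counit M Z, counit_epi M hM Z, counit_mem M Z, tensorObj_projective M _⟩) Y

/-- The `M`-Hochschild cohomology group `H_M^n(B, N)` of `B` with coefficients in `N`, for `M` a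
generator of left `B`-modules: the relative `Ext` group of `(B, N)`, that is, the `n`-th
cohomology of `Hom(P_•, N)` for a relative projective resolution `P_•` of the bimodule `B`. -/
noncomputable def hochschild (M : BimoduleCat.{u, v, u} B A)
    (hM : IsSeparator (ModuleCat.of B M)) (n : ℕ) (N : BimoduleCat.{u, u, u} B B) :
    ModuleCat.{u} ℤ :=
  (exists_resolution M hM (regular B)).some.ext N n

/-- The `M`-Hochschild dimension of `B`: the least `n` such that `H_M^{n+1}(B, N) = 0` for every
`N`, and `⊤` if there is none. -/
noncomputable def hochschildDim (M : BimoduleCat.{u, v, u} B A)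
    (hM : IsSeparator (ModuleCat.of B M)) : ℕ∞ :=
  sInf {d : ℕ∞ | ∃ n : ℕ, d = n ∧
    ∀ N : BimoduleCat.{u, u, u} B B, IsZero (hochschild M hM (n + 1) N)}

end BimoduleCat

/-!
A relative projective resolution `⋯ ⟶ P₁ ⟶ P₀ ⟶ X ⟶ 0` is governed by its syzygies
`Kₙ = ker (Pₙ ⟶ Pₙ₋₁)`, with `P₋₁ = X`. By exactness and admissibility the map `Pₙ₊₁ ⟶ Kₙ` is an
epimorphism of the class `H`.

* If `Kₙ` is relatively projective, then `Pₙ₊₁ ⟶ Kₙ` splits, so its kernel `Kₙ₊₁` is a retract of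
  `Pₙ₊₁`. Hence every cocycle `Pₙ₊₂ ⟶ N`, which is the same as a map `Kₙ₊₁ ⟶ N`, extends to `Pₙ₊₁`
  (`isZero_ext_of_syzygy`), and `Kₙ₊₁` is again relatively projective (`syzygy_succ_projective`).
* If the cohomology in degree `n + 1` vanishes for all coefficients, then the tautological cocycle
  `Pₙ₊₁ ⟶ Kₙ` extends to `Pₙ`, so `Kₙ` is a retract of `Pₙ` (`exists_retraction_of_isZero_ext`).
  Applied in degree `2` this makes `P₁ ⟶ K₀` split, and applied in degree `1` it makes `K₀` a retract
  of `P₀`; in both cases `K₀` is relatively projective.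

It follows that vanishing in degree `2`, vanishing in all degrees `≥ 2` and relative projectivity of
`K₀` are equivalent, and that vanishing in degree `1` implies them. Finally, a version of Schanuel's
lemma (`IsRelProjective.kernel_of_kernel`) shows that relative projectivity of the kernel of a map
`P ⟶ X` of the class `H` from a relatively projective object does not depend on that map. For `X = B`
one such map is the augmentation, with kernel `K₀`, and another is the evaluation map, whose kernel
is relatively projective precisely when `M` is formally smooth.
-/

namespace RelativeHomology

/-! ### Relatively projective objects -/

section Projective

variable {C : Type u} [Category.{v} C] {H : MorphismProperty C}

lemma IsRelProjective.of_retract {P Q : C} (hP : IsRelProjective H P) (i : Q ⟶ P) (r : P ⟶ Q)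
    (h : i ≫ r = 𝟙 Q) : IsRelProjective H Q := by
  intro X Y f hf g
  obtain ⟨l, hl⟩ := hP f hf (r ≫ g)
  exact ⟨i ≫ l, by simpa [reassoc_of% h] using congrArg (fun k => i ≫ k) hl⟩

/-- Schanuel's lemma for relatively projective objects: whether the kernel of a map of the class `H`
from a relatively projective object onto `X` is relatively projective does not depend on the map. -/
lemma IsRelProjective.kernel_of_kernel [Preadditive C] [HasKernels C] {P Q X : C} {p : P ⟶ X}
    {q : Q ⟶ X} (hP : IsRelProjective H P) (hQ : IsRelProjective H Q) (hp : H p) (hq : H q)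
    (hK : IsRelProjective H (kernel p)) : IsRelProjective H (kernel q) := by
  obtain ⟨a, ha : a ≫ q = p⟩ := hP q hq p
  obtain ⟨b, hb : b ≫ p = q⟩ := hQ p hp q
  -- `b` and `a` induce maps of kernels whose composite differs from the identity by a map
  -- through `Q`, so every map out of `kernel q` is a sum of maps through `kernel p` and `Q`.
  let a' : kernel p ⟶ kernel q := kernel.lift q (kernel.ι p ≫ a) (by simp [ha])
  let b' : kernel q ⟶ kernel p := kernel.lift p (kernel.ι q ≫ b) (by simp [hb])
  let h : Q ⟶ kernel q := kernel.lift q (𝟙 Q - b ≫ a) (by simp [ha, hb])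
  have key : b' ≫ a' + kernel.ι q ≫ h = 𝟙 (kernel q) := by
    rw [← cancel_mono (kernel.ι q)]
    simp [a', b', h]
  intro Y Z f hf g
  obtain ⟨l, hl : l ≫ f = a' ≫ g⟩ := hK f hf (a' ≫ g)
  obtain ⟨m, hm : m ≫ f = h ≫ g⟩ := hQ f hf (h ≫ g)
  refine ⟨b' ≫ l + kernel.ι q ≫ m, ?_⟩
  simp only [Preadditive.add_comp, Category.assoc, hl, hm]
  simpa using congrArg (fun k => k ≫ g) key

instance relSplit_respectsIso {D : Type*} [Category* D] (R : C ⥤ D) :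
    (relSplit R).RespectsIso := by
  apply MorphismProperty.RespectsIso.mk
  · rintro X Y Z e f ⟨s, hs⟩
    exact ⟨s ≫ R.map e.inv, by simp [← Functor.map_comp, hs]⟩
  · rintro X Y Z e f ⟨s, hs⟩
    exact ⟨R.map e.inv ≫ s, by
      rw [Functor.map_comp, Category.assoc, reassoc_of% hs, ← Functor.map_comp, e.inv_hom_id,
        CategoryTheory.Functor.map_id]⟩

end Projective

/-! ### Syzygies of a relative projective resolution -/

section Syzygy

variable {C : Type u} [Category.{v} C] [Abelian C] {H : MorphismProperty C} {X : C}

/-- For an admissible `f` and an exact sequence `f`, `g`, the class `H` contains the map from the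
source of `f` onto the kernel of `g`. -/
lemma IsAdmissible.kernel_lift_mem [H.RespectsIso] {Y Z W : C} {f : Y ⟶ Z} {g : Z ⟶ W}
    (hf : IsAdmissible H f) (w : f ≫ g = 0) (hfg : (ShortComplex.mk f g w).Exact) :
    H (kernel.lift g f w) := by
  obtain ⟨I, ξ, μ, _, _, rfl, hξ⟩ := hf
  have hμ : μ ≫ g = 0 := by rw [← cancel_epi ξ]; simpa using w
  have : Epi (kernel.lift g (ξ ≫ μ) w) := hfg.epi_kernelLift
  have fac : ξ ≫ kernel.lift g μ hμ = kernel.lift g (ξ ≫ μ) w := by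
    rw [← cancel_mono (kernel.ι g)]; simp
  have : Epi (ξ ≫ kernel.lift g μ hμ) := fac ▸ this
  have : Epi (kernel.lift g μ hμ) := epi_of_epi ξ _
  have : Mono (kernel.lift g μ hμ) := by
    have : Mono (kernel.lift g μ hμ ≫ kernel.ι g) := by simpa
    exact mono_of_mono _ (kernel.ι g)
  have : IsIso (kernel.lift g μ hμ) := isIso_of_mono_of_epi _
  rw [← fac]
  exact (MorphismProperty.cancel_right_of_respectsIso H ξ _).2 hξ

namespace RelProjectiveResolution

lemma aug_mem [H.RespectsIso] (P : RelProjectiveResolution H X) : H P.aug := by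
  obtain ⟨I, ξ, μ, _, _, h, hξ⟩ := P.admissible_aug
  have := P.epi_aug
  rw [← h] at this ⊢
  have : Epi μ := epi_of_epi ξ μ
  have : IsIso μ := isIso_of_mono_of_epi μ
  exact (MorphismProperty.cancel_right_of_respectsIso H ξ μ).2 hξ

variable (P : RelProjectiveResolution H X)

/-- The objects of the augmented resolution, shifted by one: `X`, `P₀`, `P₁`, … -/
noncomputable def target : ℕ → C
  | 0 => X
  | n + 1 => P.complex.X n

/-- The maps of the augmented resolution: the augmentation, followed by the differentials. -/
noncomputable def augD : ∀ n, P.complex.X n ⟶ P.target n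
  | 0 => P.aug
  | n + 1 => P.complex.d (n + 1) n

/-- The `n`-th syzygy: the kernel of `P₀ ⟶ X` for `n = 0` and of `Pₙ ⟶ Pₙ₋₁` for `n > 0`. -/
noncomputable def syzygy (n : ℕ) : C := kernel (P.augD n)

/-- The inclusion of the `n`-th syzygy into `Pₙ`. -/
noncomputable def syzygyι (n : ℕ) : P.syzygy n ⟶ P.complex.X n := kernel.ι (P.augD n)

instance (n : ℕ) : Mono (P.syzygyι n) := inferInstanceAs (Mono (kernel.ι _))

lemma d_augD (n : ℕ) : P.complex.d (n + 1) n ≫ P.augD n = 0 := by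
  cases n with
  | zero => exact P.d_aug
  | succ n => exact P.complex.d_comp_d _ _ _

lemma exact_augD (n : ℕ) : (ShortComplex.mk _ _ (P.d_augD n)).Exact := by
  cases n with
  | zero => exact P.exact_zero
  | succ n =>
    exact (HomologicalComplex.exactAt_iff' _ (n + 1 + 1) (n + 1) n (by simp) (by simp)).1
      (P.exact_succ n)

/-- The map from `Pₙ₊₁` onto the `n`-th syzygy. -/
noncomputable def toSyzygy (n : ℕ) : P.complex.X (n + 1) ⟶ P.syzygy n :=
  kernel.lift (P.augD n) (P.complex.d (n + 1) n) (P.d_augD n)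

instance (n : ℕ) : Epi (P.toSyzygy n) := (P.exact_augD n).epi_kernelLift

lemma toSyzygy_mem [H.RespectsIso] (n : ℕ) : H (P.toSyzygy n) :=
  (P.admissible n).kernel_lift_mem (P.d_augD n) (P.exact_augD n)

lemma toSyzygy_ι (n : ℕ) : P.toSyzygy n ≫ P.syzygyι n = P.complex.d (n + 1) n :=
  kernel.lift_ι _ _ _

lemma ι_toSyzygy (n : ℕ) : P.syzygyι (n + 1) ≫ P.toSyzygy n = 0 := by
  rw [← cancel_mono (P.syzygyι n), Category.assoc, toSyzygy_ι, zero_comp]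
  exact kernel.condition (P.complex.d (n + 1) n)

/-- The `n`-th syzygy is the cokernel of the inclusion of the next one into `Pₙ₊₁`. -/
lemma exists_desc {n : ℕ} {Y : C} (f : P.complex.X (n + 1) ⟶ Y) (hf : P.syzygyι (n + 1) ≫ f = 0) :
    ∃ g, P.toSyzygy n ≫ g = f := by
  have ex : (ShortComplex.mk _ _ (P.ι_toSyzygy n)).Exact := by
    apply ShortComplex.exact_of_f_is_kernel
    refine KernelFork.IsLimit.ofι' _ _ fun k hk => ⟨kernel.lift (P.augD (n + 1)) k ?_, ?_⟩
    · change k ≫ P.complex.d (n + 1) n = 0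
      rw [← toSyzygy_ι, ← Category.assoc, hk, zero_comp]
    · exact kernel.lift_ι _ _ _
  have : Epi (ShortComplex.mk _ _ (P.ι_toSyzygy n)).g := inferInstanceAs (Epi (P.toSyzygy n))
  exact ⟨ex.desc f hf, ex.g_desc f hf⟩

lemma exists_lift {n : ℕ} {Y : C} (f : Y ⟶ P.complex.X (n + 1)) (hf : f ≫ P.toSyzygy n = 0) :
    ∃ g, g ≫ P.syzygyι (n + 1) = f := by
  refine ⟨kernel.lift (P.augD (n + 1)) f ?_, kernel.lift_ι _ _ _⟩
  change f ≫ P.complex.d (n + 1) n = 0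
  rw [← toSyzygy_ι, ← Category.assoc, hf, zero_comp]

/-- If the `n`-th syzygy is relatively projective, then `Pₙ₊₁` splits onto it, so that the next
syzygy is a retract of `Pₙ₊₁`. -/
lemma exists_retraction_of_syzygy [H.RespectsIso] {n : ℕ} (h : IsRelProjective H (P.syzygy n)) :
    ∃ r, P.syzygyι (n + 1) ≫ r = 𝟙 _ := by
  obtain ⟨s, hs : s ≫ P.toSyzygy n = 𝟙 _⟩ := h _ (P.toSyzygy_mem n) (𝟙 _)
  obtain ⟨r, hr⟩ := P.exists_lift (𝟙 _ - P.toSyzygy n ≫ s) (by simp [hs])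
  exact ⟨r, by rw [← cancel_mono (P.syzygyι (n + 1))]; simp [hr, reassoc_of% P.ι_toSyzygy n]⟩

/-- If the `(n + 1)`-st syzygy is a retract of `Pₙ₊₁`, then `Pₙ₊₁` splits onto the `n`-th
syzygy. -/
lemma syzygy_of_retraction_succ {n : ℕ} (r : P.complex.X (n + 1) ⟶ P.syzygy (n + 1))
    (hr : P.syzygyι (n + 1) ≫ r = 𝟙 _) : IsRelProjective H (P.syzygy n) := by
  obtain ⟨s, hs⟩ := P.exists_desc (𝟙 _ - r ≫ P.syzygyι (n + 1)) (by simp [reassoc_of% hr])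
  refine (P.projective (n + 1)).of_retract s (P.toSyzygy n) ?_
  rw [← cancel_epi (P.toSyzygy n), ← Category.assoc, hs]
  simp [ι_toSyzygy]

lemma syzygy_succ_projective [H.RespectsIso] {n : ℕ} (h : IsRelProjective H (P.syzygy n)) :
    IsRelProjective H (P.syzygy (n + 1)) := by
  obtain ⟨r, hr⟩ := P.exists_retraction_of_syzygy h
  exact (P.projective (n + 1)).of_retract _ r hr

lemma syzygy_projective [H.RespectsIso] (h : IsRelProjective H (P.syzygy 0)) (n : ℕ) :
    IsRelProjective H (P.syzygy n) := by
  induction n with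
  | zero => exact h
  | succ n ih => exact P.syzygy_succ_projective ih

/-! ### Vanishing of relative cohomology -/

lemma isZero_ext_succ_iff (Y : C) (n : ℕ) :
    IsZero (P.ext Y (n + 1)) ↔ ∀ φ : P.complex.X (n + 1) ⟶ Y,
      P.complex.d (n + 2) (n + 1) ≫ φ = 0 → ∃ ψ, P.complex.d (n + 1) n ≫ ψ = φ := by
  rw [ext, ← HomologicalComplex.exactAt_iff_isZero_homology,
    HomologicalComplex.exactAt_iff' _ n (n + 1) (n + 2) (by simp) (by simp),
    ShortComplex.moduleCat_exact_iff]
  rfl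

/-- A cocycle `Pₙ₊₁ ⟶ Y` vanishes on the syzygy in `Pₙ₊₁`, so that it factors through `Pₙ₊₁ ⟶ Kₙ`. -/
lemma ι_comp_eq_zero {n : ℕ} {Y : C} {φ : P.complex.X (n + 1) ⟶ Y}
    (hφ : P.complex.d (n + 2) (n + 1) ≫ φ = 0) : P.syzygyι (n + 1) ≫ φ = 0 := by
  rw [← cancel_epi (P.toSyzygy (n + 1)), reassoc_of% P.toSyzygy_ι, hφ, comp_zero]

lemma isZero_ext_of_syzygy [H.RespectsIso] {n : ℕ} (h : IsRelProjective H (P.syzygy n)) (Y : C) :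
    IsZero (P.ext Y (n + 2)) := by
  rw [isZero_ext_succ_iff]
  intro φ hφ
  obtain ⟨r, hr⟩ := P.exists_retraction_of_syzygy h
  obtain ⟨g, rfl⟩ := P.exists_desc φ (P.ι_comp_eq_zero hφ)
  exact ⟨r ≫ g, by rw [← toSyzygy_ι, Category.assoc, reassoc_of% hr]⟩

/-- If the cohomology in degree `n + 1` with coefficients in the `n`-th syzygy vanishes, then the
tautological cocycle `Pₙ₊₁ ⟶ Kₙ` extends to a retraction of `Pₙ` onto `Kₙ`. -/
lemma exists_retraction_of_isZero_ext {n : ℕ} (h : IsZero (P.ext (P.syzygy n) (n + 1))) :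
    ∃ r, P.syzygyι n ≫ r = 𝟙 _ := by
  obtain ⟨r, hr⟩ := (P.isZero_ext_succ_iff _ _).1 h (P.toSyzygy n)
    (by rw [← toSyzygy_ι, Category.assoc, ι_toSyzygy, comp_zero])
  refine ⟨r, ?_⟩
  rw [← cancel_epi (P.toSyzygy n), reassoc_of% P.toSyzygy_ι, hr, Category.comp_id]

end RelProjectiveResolution

end Syzygy

end RelativeHomology

/-! ### Formally smooth bimodules -/

namespace BimoduleCat

variable {A : Type v} {B : Type u} [Ring A] [Ring B]

instance splitClass_respectsIso (M : BimoduleCat.{u, v, u} B A) : (splitClass B M).RespectsIso :=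
  RelativeHomology.relSplit_respectsIso _

/-- The evaluation map and the augmentation of a resolution of `B` both belong to the split class and
have relatively projective sources, so their kernels are relatively projective simultaneously. -/
lemma isFormallySmooth_iff_syzygy (M : BimoduleCat.{u, v, u} B A)
    (P : RelativeHomology.RelProjectiveResolution (splitClass B M) (regular B)) :
    M.IsFormallySmooth ↔ RelativeHomology.IsRelProjective (splitClass B M) (P.syzygy 0) :=
  ⟨(tensorObj_projective M _).kernel_of_kernel (P.projective 0) (counit_mem M _) P.aug_mem,
    (P.projective 0).kernel_of_kernel (tensorObj_projective M _) P.aug_mem (counit_mem M _)⟩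

lemma hochschildDim_le_one_iff (M : BimoduleCat.{u, v, u} B A)
    (hM : IsSeparator (ModuleCat.of B M)) :
    M.hochschildDim hM ≤ 1 ↔
      (∀ N : BimoduleCat.{u, u, u} B B, IsZero (M.hochschild hM 1 N)) ∨
        ∀ N : BimoduleCat.{u, u, u} B B, IsZero (M.hochschild hM 2 N) := by
  constructor
  · intro h
    -- The infimum of the empty set is `⊤`; that of a nonempty set belongs to the set.
    have hne : {d : ℕ∞ | ∃ n : ℕ, d = n ∧
        ∀ N : BimoduleCat.{u, u, u} B B, IsZero (hochschild M hM (n + 1) N)}.Nonempty := by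
      by_contra hne
      rw [hochschildDim, Set.not_nonempty_iff_eq_empty.1 hne, sInf_empty] at h
      exact absurd h (by decide)
    obtain ⟨n, hn, hz⟩ := csInf_mem hne
    rw [hochschildDim, hn] at h
    have h1 : n ≤ 1 := by exact_mod_cast h
    interval_cases n
    · exact Or.inl hz
    · exact Or.inr hz
  · rintro (h | h)
    · exact sInf_le_of_le ⟨0, rfl, h⟩ (by simp)
    · exact sInf_le_of_le ⟨1, rfl, h⟩ (by simp)

end BimoduleCat

theorem mainTheorem1 {A : Type v} {B : Type u} [Ring A] [Ring B]
    (M : BimoduleCat.{u, v, u} B A) (hM : IsSeparator (ModuleCat.of B M)) :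
    List.TFAE [
      M.IsFormallySmooth,
      ∀ (N : BimoduleCat.{u, u, u} B B) (n : ℕ), 2 ≤ n → IsZero (M.hochschild hM n N),
      ∀ N : BimoduleCat.{u, u, u} B B, IsZero (M.hochschild hM 2 N),
      M.hochschildDim hM ≤ 1] := by
  let P := (BimoduleCat.exists_resolution M hM (BimoduleCat.regular B)).some
  rw [M.isFormallySmooth_iff_syzygy P, M.hochschildDim_le_one_iff hM]
  tfae_have 1 → 2 := fun h N n hn => by
    obtain ⟨n, rfl⟩ := Nat.exists_eq_add_of_le' hn
    exact P.isZero_ext_of_syzygy (P.syzygy_projective h n) N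
  tfae_have 2 → 3 := fun h N => h N 2 le_rfl
  tfae_have 3 → 4 := Or.inr
  tfae_have 4 → 1 := by
    rintro (h | h)
    · obtain ⟨r, hr⟩ := P.exists_retraction_of_isZero_ext (n := 0) (h _)
      exact (P.projective 0).of_retract _ r hr
    · obtain ⟨r, hr⟩ := P.exists_retraction_of_isZero_ext (n := 1) (h _)
      exact P.syzygy_of_retraction_succ r hr
  tfae_finish
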